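/- Let $T>0$, let $(\Omega,\mathcal F,(\mathcal F_s)_{s\in[0,T]},\mathbb P)$ be a filtered probability space with $\mathcal F_0=\{\emptyset,\Omega\}$ and $\mathcal F_T=\mathcal F$, and understand all (in)equalities and limits of random variables $\mathbb P$-almost surely. A dynamic risk measure is a family of maps $\rho_s:L^\infty(\mathcal F_T)\to L^\infty(\mathcal F_s)$, $s\in[0,T]$, with $\rho_T(X)=-X$. It is cash-subadditive if $\rho_s(X+m)\ge\rho_s(X)-m$ for all $s$, $X\in L^\infty(\mathcal F_T)$ and $0\le m\in L^\infty(\mathcal F_s)$, and continuous from above if $X_n\downarrow X$ in $L^\infty(\mathcal F_T)$ implies $\rho_s(X_n)\uparrow\rho_s(X)$. Fix $t\in[0,T]$. A scenario is a pair $(D,\mathbb Q_t)$ of an adapted process $D=(D_s)_{s\in[0,T]}$ with values in $[0,1]$ and a probability measure $\mathbb Q_t\ll\mathbb P$ with $\mathbb Q_t=\mathbb P$ on $\mathcal F_t$; its density is $D_t\,\frac{d\mathbb Q_t}{d\mathbb P}$ and its (minimal) penalty is $$c_t(D_t\mathbb Q_t)=\operatorname*{ess\,sup}_{Y\in L^\infty(\mathcal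 F_T)}\{D_t\,\mathbb E_{\mathbb Q_t}[-Y\mid\mathcal F_t]-\rho_t(Y)\}\in(-\infty,+\infty].$$ A scenario is optimal at $X$ if it attains the essential supremum $\operatorname{ess\,sup}_{(D,\mathbb Q_t)}\{D_t\mathbb E_{\mathbb Q_t}[-X\mid\mathcal F_t]-c_t(D_t\mathbb Q_t)\}$ over all scenarios. The subdifferential of $\rho_t$ at $X$ is $$\partial\rho_t(X)=\{Z\in L^1_+(\mathcal F_T):\ \rho_t(Y)\ge\rho_t(X)+\mathbb E[-Z(Y-X)\mid\mathcal F_t]\ \text{for all }Y\in L^\infty(\mathcal F_T)\}.$$ Let $\rho$ be cash-subadditive and continuous from above, and let $X\in L^\infty(\mathcal F_T)$ be such that the dual representation $$\rho_t(X)=\operatorname*{ess\,sup}_{(D,\mathbb Q_t)}\{D_t\,\mathbb E_{\mathbb Q_t}[-X\mid\mathcal F_t]-c_t(D_t\mathbb Q_t)\}$$ holds with the essential supremum attained by some scenario. Then: 1. A scenario $(D,\mathbb Q_t)$ is optimal at $X$ if and only if $D_t\frac{d\mathbb Q_t}{d\mathbb P}\in\partial\rho_t(X)$; moreover every element of $\partial\rho_t(X)$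 is the density of an optimal scenario. 2. If for every $Y\in L^\infty(\mathcal F_T)$ the directional derivative $\lim_{h\to0}\frac{\rho_t(X+hY)-\rho_t(X)}h$ exists (as an almost sure limit along every sequence of nonzero $h$ tending to $0$), then $\partial\rho_t(X)$ is a singleton. In particular, $\partial\rho_t(X)$ is a singleton if $\rho_t$ is Gateaux differentiable at $X$, that is, if there is $G\in L^1_+(\mathcal F_T)$ such that $\lim_{h\downarrow0}\frac{\rho_t(X+hY)-\rho_t(X)}h=\mathbb E[-YG\mid\mathcal F_t]$ for every $Y\in L^\infty(\mathcal F_T)$ (in the same sense). -/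

import Mathlib

open MeasureTheory Filter Topology ProbabilityTheory
open scoped ENNReal

namespace DynRisk

/-! ### Essential suprema of arbitrary families of extended real random variables -/

section EssSup

variable {Ω : Type*} {mΩ : MeasurableSpace Ω} {P : Measure Ω}

/-- A bounded strictly increasing transform of the extended reals. -/
noncomputable def squash (x : EReal) : ℝ≥0∞ := (1 + EReal.exp (-x))⁻¹

theorem squash_strictMono : StrictMono squash := by
  intro x y hxy
  have h1 : EReal.exp (-y) < EReal.exp (-x) :=
    EReal.exp_strictMono (EReal.neg_lt_neg_iff.2 hxy)
  exact ENNReal.inv_lt_inv.2 (ENNReal.add_lt_add_left ENNReal.one_ne_top h1)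

theorem squash_le_one (x : EReal) : squash x ≤ 1 :=
  ENNReal.inv_le_one.2 le_self_add

/-- Every family of (classes of) extended real random variables has a least upper bound for the
almost sure order. -/
theorem exists_isLUB_aeEqFun [IsFiniteMeasure P] (S : Set (Ω →ₘ[P] EReal)) :
    ∃ c, IsLUB S c := by
  rcases S.eq_empty_or_nonempty with rfl | hS
  · refine ⟨AEEqFun.const Ω ⊥, by simp, fun b _ => ?_⟩
    rw [← AEEqFun.coeFn_le]
    filter_upwards [AEEqFun.coeFn_const Ω (⊥ : EReal) (μ := P)] with ω h
    rw [h]; exact bot_le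
  have : Nonempty S := hS.to_subtype
  have hmeas : ∀ u : ℕ → S, Measurable (fun ω => ⨆ n, (u n : Ω →ₘ[P] EReal) ω) := fun u =>
    Measurable.iSup fun n => (u n : Ω →ₘ[P] EReal).measurable
  have hsq : Measurable squash := squash_strictMono.monotone.measurable
  let I : (ℕ → S) → ℝ≥0∞ := fun u => ∫⁻ ω, squash (⨆ n, (u n : Ω →ₘ[P] EReal) ω) ∂P
  have hI : ∀ u, I u ≠ ∞ := fun u => by
    refine ne_top_of_le_ne_top (measure_ne_top P Set.univ) ?_
    calc I u ≤ ∫⁻ _, 1 ∂P := lintegral_mono fun ω => squash_le_one _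
      _ = P Set.univ := by simp
  obtain ⟨a, ha, hlim⟩ := exists_seq_tendsto_sSup (S := Set.range I) (Set.range_nonempty I)
    (OrderTop.bddAbove _)
  choose u hu using hlim.2
  let v : ℕ → S := fun n => u n.unpair.1 n.unpair.2
  have hIv : ∀ w, I w ≤ I v := by
    intro w
    refine (le_sSup (Set.mem_range_self w)).trans (le_of_tendsto' hlim.1 fun k => ?_)
    rw [← hu k]
    refine lintegral_mono fun ω => squash_strictMono.monotone (iSup_le fun n => ?_)
    refine le_iSup_of_le (Nat.pair k n) ?_
    simp [v]
  refine ⟨AEEqFun.mk _ (hmeas v).aestronglyMeasurable, fun f hf => ?_, fun b hb => ?_⟩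
  · let w : ℕ → S := fun n => Nat.casesOn (motive := fun _ => S) n ⟨f, hf⟩ v
    have hle : ∀ ω, (⨆ n, (v n : Ω →ₘ[P] EReal) ω) ≤ ⨆ n, (w n : Ω →ₘ[P] EReal) ω :=
      fun ω => iSup_le fun n => le_iSup_of_le (n + 1) le_rfl
    have hEq := ae_eq_of_ae_le_of_lintegral_le
      (Eventually.of_forall fun ω => squash_strictMono.monotone (hle ω)) (hI v)
      (hsq.comp (hmeas w)).aemeasurable (hIv w)
    rw [← AEEqFun.coeFn_le]
    filter_upwards [hEq, AEEqFun.coeFn_mk _ (hmeas v).aestronglyMeasurable (μ := P)] with ω h1 h2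
    rw [h2, squash_strictMono.injective h1]
    exact le_iSup (fun k => (w k : Ω →ₘ[P] EReal) ω) 0
  · rw [← AEEqFun.coeFn_le]
    have hall : ∀ᵐ ω ∂P, ∀ n, (v n : Ω →ₘ[P] EReal) ω ≤ b ω :=
      ae_all_iff.2 fun n => AEEqFun.coeFn_le.2 (hb (v n).2)
    filter_upwards [hall, AEEqFun.coeFn_mk _ (hmeas v).aestronglyMeasurable (μ := P)] with ω h1 h2
    rw [h2]
    exact iSup_le h1

/-- The essential supremum of a family of extended real random variables. -/
noncomputable def familyEssSup [IsFiniteMeasure P] (S : Set (Ω →ₘ[P] EReal)) : Ω →ₘ[P] EReal :=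
  Classical.choose (exists_isLUB_aeEqFun S)

theorem isLUB_familyEssSup [IsFiniteMeasure P] (S : Set (Ω →ₘ[P] EReal)) :
    IsLUB S (familyEssSup S) :=
  Classical.choose_spec (exists_isLUB_aeEqFun S)

end EssSup

/-! ### Dynamic risk measures -/

section RiskMeasures

variable {Ω : Type*} {mΩ : MeasurableSpace Ω}

/-- `LInfty 𝒢 P` is `L^∞(𝒢)`: classes of essentially bounded, `𝒢`-measurable random variables. -/
noncomputable abbrev LInfty {Ω : Type*} (𝒢 : MeasurableSpace Ω) {mΩ : MeasurableSpace Ω}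
    (P : Measure Ω) : Submodule ℝ (Lp ℝ ∞ P) :=
  lpMeas ℝ ℝ 𝒢 ∞ P

/-- A dynamic risk measure: a family of maps `ρ_t : L^∞(𝓕_T) → L^∞(𝓕_t)`, `t ∈ [0, T]`, with
`ρ_T(X) = -X`. The σ-algebra of the probability space plays the role of `𝓕_T`. -/
structure DynamicRiskMeasure {T : ℝ} (hT : 0 < T) (ℱ : Filtration (Set.Icc (0 : ℝ) T) mΩ)
    (P : Measure Ω) where
  risk : (t : Set.Icc (0 : ℝ) T) → Lp ℝ ∞ P → LInfty (ℱ t) P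
  terminal : ∀ X : Lp ℝ ∞ P, (risk ⟨T, hT.le, le_rfl⟩ X : Lp ℝ ∞ P) = -X

variable {T : ℝ} {hT : 0 < T} {ℱ : Filtration (Set.Icc (0 : ℝ) T) mΩ} {P : Measure Ω}

/-- `ρ_t(X)` as an element of `L^∞`. -/
noncomputable def DynamicRiskMeasure.val (ρ : DynamicRiskMeasure hT ℱ P)
    (t : Set.Icc (0 : ℝ) T) (X : Lp ℝ ∞ P) : Lp ℝ ∞ P :=
  (ρ.risk t X : Lp ℝ ∞ P)

/-- `ρ_t(X + m_t) ≥ ρ_t(X) - m_t` for nonnegative `m_t ∈ L^∞(𝓕_t)`. -/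
def CashSubadditive (ρ : DynamicRiskMeasure hT ℱ P) : Prop :=
  ∀ (t : Set.Icc (0 : ℝ) T) (X m : Lp ℝ ∞ P), m ∈ LInfty (ℱ t) P → 0 ≤ m →
    ρ.val t X - m ≤ ρ.val t (X + m)

/-- `X_n ↓ X` almost surely implies `ρ_t(X_n) ↑ ρ_t(X)` almost surely. -/
def ContinuousFromAbove (ρ : DynamicRiskMeasure hT ℱ P) : Prop :=
  ∀ (t : Set.Icc (0 : ℝ) T) (Xs : ℕ → Lp ℝ ∞ P) (X : Lp ℝ ∞ P), Antitone Xs →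
    (∀ᵐ ω ∂P, Tendsto (fun n => Xs n ω) atTop (𝓝 (X ω))) →
    Monotone (fun n => ρ.val t (Xs n)) ∧
      ∀ᵐ ω ∂P, Tendsto (fun n => ρ.val t (Xs n) ω) atTop (𝓝 (ρ.val t X ω))

/-! ### Scenarios, penalty and dual representation -/

/-- A scenario `(D, Q)` at time `t`: an adapted discount process `D` with values in `[0, 1]`, and a
probability measure `Q ≪ P` that coincides with `P` on `𝓕_t`. -/
structure Scenario (ℱ : Filtration (Set.Icc (0 : ℝ) T) mΩ) (P : Measure Ω)
    (t : Set.Icc (0 : ℝ) T) where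
  D : Set.Icc (0 : ℝ) T → Ω → ℝ
  adapted : StronglyAdapted ℱ D
  mem_Icc : ∀ s, ∀ᵐ ω ∂P, D s ω ∈ Set.Icc (0 : ℝ) 1
  Q : Measure Ω
  isProb : IsProbabilityMeasure Q
  absCont : Q ≪ P
  trim_eq : Q.trim (ℱ.le t) = P.trim (ℱ.le t)

variable {t : Set.Icc (0 : ℝ) T}

/-- `D_t E_Q[-X | 𝓕_t]`. Since `Q = P` on `𝓕_t`, this is well defined `P`-almost surely. -/
noncomputable def Scenario.discountedLoss (s : Scenario ℱ P t) (X : Lp ℝ ∞ P) : Ω → ℝ :=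
  fun ω => s.D t ω * (s.Q[fun ω' => -X ω' | ℱ t]) ω

theorem Scenario.discountedLoss_aestronglyMeasurable (s : Scenario ℱ P t) (X : Lp ℝ ∞ P) :
    AEStronglyMeasurable (s.discountedLoss X) P :=
  (((s.adapted t).mul stronglyMeasurable_condExp).mono (ℱ.le t)).aestronglyMeasurable

/-- The class of an almost everywhere measurable real function, as extended real random
variable. -/
noncomputable def toEReal (f : Ω → ℝ) (hf : AEStronglyMeasurable f P) : Ω →ₘ[P] EReal :=
  AEEqFun.mk (fun ω => (f ω : EReal)) (continuous_coe_real_ereal.comp_aestronglyMeasurable hf)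

/-- The minimal penalty `c_t(D_t Q)`, the essential supremum over `X ∈ L^∞(𝓕_T)` of
`D_t E_Q[-X | 𝓕_t] - ρ_t(X)`; it may take the value `+∞`. -/
noncomputable def minimalPenalty [IsFiniteMeasure P] (ρ : DynamicRiskMeasure hT ℱ P)
    (s : Scenario ℱ P t) : Ω →ₘ[P] EReal :=
  familyEssSup (Set.range fun X : Lp ℝ ∞ P =>
    toEReal (fun ω => s.discountedLoss X ω - ρ.val t X ω)
      ((s.discountedLoss_aestronglyMeasurable X).sub (Lp.aestronglyMeasurable _)))

/-- The random variable `D_t E_Q[-X | 𝓕_t] - c_t(D_t Q)` that is maximised in the dual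
representation; it equals `-∞` where the penalty is `+∞`. -/
noncomputable def dualObjective [IsFiniteMeasure P] (ρ : DynamicRiskMeasure hT ℱ P)
    (X : Lp ℝ ∞ P) (s : Scenario ℱ P t) : Ω →ₘ[P] EReal :=
  AEEqFun.mk (fun ω => (s.discountedLoss X ω : EReal) - minimalPenalty ρ s ω)
    (((measurable_coe_real_ereal.comp_aemeasurable
      (s.discountedLoss_aestronglyMeasurable X).aemeasurable).sub
        (minimalPenalty ρ s).measurable.aemeasurable).aestronglyMeasurable)

/-- The essential supremum over all scenarios in the dual representation of `ρ_t(X)`. -/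
noncomputable def dualValue [IsFiniteMeasure P] (ρ : DynamicRiskMeasure hT ℱ P)
    (t : Set.Icc (0 : ℝ) T) (X : Lp ℝ ∞ P) : Ω →ₘ[P] EReal :=
  familyEssSup (Set.range fun s : Scenario ℱ P t => dualObjective ρ X s)

/-- A scenario is optimal at `X` if it attains the essential supremum over all scenarios. -/
def IsOptimal [IsFiniteMeasure P] (ρ : DynamicRiskMeasure hT ℱ P) (X : Lp ℝ ∞ P)
    (s : Scenario ℱ P t) : Prop :=
  dualObjective ρ X s = dualValue ρ t X

/-- The dual representation `ρ_t(X) = esssup {D_t E_Q[-X | 𝓕_t] - c_t(D_t Q)}` holds at `X` and the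
essential supremum is attained. -/
def RepresentationAttainedAt [IsFiniteMeasure P] (ρ : DynamicRiskMeasure hT ℱ P)
    (t : Set.Icc (0 : ℝ) T) (X : Lp ℝ ∞ P) : Prop :=
  toEReal (ρ.val t X) (Lp.aestronglyMeasurable _) = dualValue ρ t X ∧
    ∃ s : Scenario ℱ P t, IsOptimal ρ X s

theorem Scenario.integrable_density [IsFiniteMeasure P] (s : Scenario ℱ P t) :
    Integrable (fun ω => s.D t ω * (s.Q.rnDeriv P ω).toReal) P := by
  have := s.isProb
  refine Integrable.bdd_mul (c := 1) Measure.integrable_toReal_rnDeriv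
    ((s.adapted t).mono (ℱ.le t)).aestronglyMeasurable ?_
  filter_upwards [s.mem_Icc t] with ω h
  rw [Real.norm_of_nonneg h.1]
  exact h.2

/-- The density `D_t dQ/dP` of the sub-probability `D_t Q`. -/
noncomputable def Scenario.density [IsFiniteMeasure P] (s : Scenario ℱ P t) : Lp ℝ 1 P :=
  s.integrable_density.toL1 _

/-! ### Subdifferential and directional derivatives -/

/-- The conditional subdifferential: all nonnegative `Z ∈ L^1(𝓕_T)` such that
`ρ_t(Y) ≥ ρ_t(X) + E[-Z (Y - X) | 𝓕_t]` almost surely for every `Y ∈ L^∞(𝓕_T)`. -/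
def subdifferential (ρ : DynamicRiskMeasure hT ℱ P) (t : Set.Icc (0 : ℝ) T) (X : Lp ℝ ∞ P) :
    Set (Lp ℝ 1 P) :=
  {Z | 0 ≤ Z ∧ ∀ Y : Lp ℝ ∞ P, ∀ᵐ ω ∂P,
    ρ.val t X ω + (P[fun ω' => -Z ω' * (Y ω' - X ω') | ℱ t]) ω ≤ ρ.val t Y ω}

/-- `L` is the directional derivative of `ρ_t` at `X` in the direction `Y`: the difference quotients
`(ρ_t(X + hY) - ρ_t(X)) / h` tend to `L` almost surely along every sequence of nonzero reals `h`
that tends to `0`. -/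
def HasDirectionalDeriv (ρ : DynamicRiskMeasure hT ℱ P) (t : Set.Icc (0 : ℝ) T)
    (X Y : Lp ℝ ∞ P) (L : Ω → ℝ) : Prop :=
  ∀ h : ℕ → ℝ, (∀ n, h n ≠ 0) → Tendsto h atTop (𝓝 0) →
    ∀ᵐ ω ∂P, Tendsto (fun n => (ρ.val t (X + h n • Y) ω - ρ.val t X ω) / h n) atTop (𝓝 (L ω))

/-- The one-sided directional derivative, with `h ↓ 0`. -/
def HasRightDirectionalDeriv (ρ : DynamicRiskMeasure hT ℱ P) (t : Set.Icc (0 : ℝ) T)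
    (X Y : Lp ℝ ∞ P) (L : Ω → ℝ) : Prop :=
  ∀ h : ℕ → ℝ, (∀ n, 0 < h n) → Tendsto h atTop (𝓝 0) →
    ∀ᵐ ω ∂P, Tendsto (fun n => (ρ.val t (X + h n • Y) ω - ρ.val t X ω) / h n) atTop (𝓝 (L ω))

/-- `ρ_t` is Gateaux differentiable at `X`: for some nonnegative `G ∈ L^1(𝓕_T)`, the one-sided
directional derivative in every direction `Y` exists and equals `E[-Y G | 𝓕_t]`. -/
def GateauxDifferentiableAt (ρ : DynamicRiskMeasure hT ℱ P) (t : Set.Icc (0 : ℝ) T)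
    (X : Lp ℝ ∞ P) : Prop :=
  ∃ G : Lp ℝ 1 P, 0 ≤ G ∧ ∀ Y : Lp ℝ ∞ P,
    HasRightDirectionalDeriv ρ t X Y (P[fun ω => -Y ω * G ω | ℱ t])

end RiskMeasures

end DynRisk

/-! The argument is Fenchel duality conditioned on `ℱ t`. Changing measure turns `D_t E_Q[-Y | ℱ t]`
into `E[-Z Y | ℱ t]` with `Z` the density, so the penalty is the conditional conjugate of `ρ_t`.
Equality in Fenchel–Young at `X` is the subgradient inequality (`dualObjective_eq_iff`); since the
dual value is `ρ_t(X)`, that equality is optimality.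

Conversely, cash-subadditivity forces `E[Z | ℱ t] ≤ 1` for every subgradient `Z`
(`CashSubadditive.condExp_le_one`), and such a `Z` factors as `D_t dQ/dP` with `D_t = E[Z | ℱ t]`
(`exists_scenario_density_eq`).

For uniqueness, directional derivatives dominate `E[-Z Y | ℱ t]`. Using `Y` and `-Y` gives equality,
and these conditional expectations determine `Z`. Attainment gives existence. -/

namespace DynRisk

/-- Conditional expectations may be inserted against `m`-measurable weights. -/
theorem setLIntegral_mul_ofReal_condExp {α : Type*} {m m0 : MeasurableSpace α}
    {μ : Measure α} [IsFiniteMeasure μ] (hm : m ≤ m0) {Z : α → ℝ} (hZ : Measurable Z)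
    (hZi : Integrable Z μ)
    (hZ0 : 0 ≤ᵐ[μ] Z) {g : α → ℝ≥0∞}
    (hg : Measurable[m] g) {A : Set α} (hA : MeasurableSet[m] A) :
    ∫⁻ ω in A, g ω * ENNReal.ofReal (Z ω) ∂μ
      = ∫⁻ ω in A, g ω * ENNReal.ofReal ((μ[Z | m]) ω) ∂μ := by
  have hDm : Measurable (μ[Z | m]) := (stronglyMeasurable_condExp.mono hm).measurable
  -- The measures with densities `Z` and `μ[Z | m]` agree on `m`, hence integrate the `m`-measurable
  -- `g` equally.
  have htrim : (μ.withDensity fun ω => ENNReal.ofReal (Z ω)).trim hm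
      = (μ.withDensity fun ω => ENNReal.ofReal ((μ[Z | m]) ω)).trim hm := by
    refine @Measure.ext _ m _ _ fun B hB => ?_
    rw [trim_measurableSet_eq hm hB, trim_measurableSet_eq hm hB, withDensity_apply _ (hm _ hB),
      withDensity_apply _ (hm _ hB),
      ← ofReal_integral_eq_lintegral_ofReal hZi.integrableOn (ae_restrict_of_ae hZ0),
      ← ofReal_integral_eq_lintegral_ofReal integrable_condExp.integrableOn
        (ae_restrict_of_ae (condExp_nonneg hZ0)), setIntegral_condExp hm hZi hB]
  have h := setLIntegral_trim (μ := μ.withDensity fun ω => ENNReal.ofReal (Z ω)) hm hg hA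
  rw [htrim, setLIntegral_trim hm hg hA,
    setLIntegral_withDensity_eq_setLIntegral_mul _ hDm.ennreal_ofReal (hg.mono hm le_rfl)
      (hm _ hA),
    setLIntegral_withDensity_eq_setLIntegral_mul _ hZ.ennreal_ofReal (hg.mono hm le_rfl)
      (hm _ hA)] at h
  simpa only [Pi.mul_apply, mul_comm (g _)] using h.symm

section

variable {Ω : Type*} {mΩ : MeasurableSpace Ω} {T : ℝ} {hT : 0 < T}
  {ℱ : Filtration (Set.Icc (0 : ℝ) T) mΩ} {P : Measure Ω} [IsProbabilityMeasure P]
  {t : Set.Icc (0 : ℝ) T}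

set_option linter.unusedSectionVars false

theorem exists_ae_norm_le (Y : Lp ℝ ∞ P) : ∃ C : ℝ, ∀ᵐ ω ∂P, ‖Y ω‖ ≤ C := by
  refine ⟨‖Y‖, ?_⟩
  have h := ae_le_eLpNormEssSup (μ := P) (f := (Y : Ω → ℝ))
  have hfin : eLpNorm Y ∞ P ≠ ∞ := Lp.eLpNorm_ne_top Y
  filter_upwards [h] with ω hω
  rw [Lp.norm_def, ← toReal_enorm]
  exact ENNReal.toReal_mono hfin (by simpa [eLpNorm_exponent_top] using hω)

/-! ### Change of measure -/

theorem integrable_neg_mul (Z : Lp ℝ 1 P) (Y : Lp ℝ ∞ P) :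
    Integrable (fun ω => -Z ω * Y ω) P := by
  obtain ⟨C, hC⟩ := exists_ae_norm_le Y
  exact (L1.integrable_coeFn Z).neg.mul_bdd (Lp.aestronglyMeasurable Y) hC

theorem Scenario.coeFn_density (s : Scenario ℱ P t) :
    s.density =ᵐ[P] fun ω => s.D t ω * (s.Q.rnDeriv P ω).toReal :=
  Integrable.coeFn_toL1 _

/-- Change of measure: `D_t E_Q[-Y | 𝓕_t] = E_P[-(D_t dQ/dP) Y | 𝓕_t]`. -/
theorem Scenario.discountedLoss_ae_eq (s : Scenario ℱ P t) (Y : Lp ℝ ∞ P) :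
    s.discountedLoss Y =ᵐ[P] P[fun ω => -s.density ω * Y ω | ℱ t] := by
  have := s.isProb
  obtain ⟨C, hC⟩ := exists_ae_norm_le Y
  have hYQ : Integrable (fun ω => -Y ω) s.Q :=
    (Integrable.of_bound ((Lp.aestronglyMeasurable Y).mono_ac s.absCont) C
      (s.absCont.ae_le hC)).neg
  have hint : Integrable (fun ω => (s.Q.rnDeriv P ω).toReal * -Y ω) P :=
    Measure.integrable_toReal_rnDeriv.mul_bdd (Lp.aestronglyMeasurable Y).neg
      (by simpa using hC)
  have hsm : StronglyMeasurable[ℱ t] (s.Q[fun ω => -Y ω | ℱ t]) := stronglyMeasurable_condExp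
  have hcP : Integrable (s.Q[fun ω => -Y ω | ℱ t]) P := by
    have h : Integrable (s.Q[fun ω => -Y ω | ℱ t]) (s.Q.trim (ℱ.le t)) :=
      integrable_condExp.trim (ℱ.le t) hsm
    rw [s.trim_eq] at h
    exact integrable_of_integrable_trim (ℱ.le t) h
  -- Over sets of `ℱ t`, integrals of `ℱ t`-measurable functions are the same under `P` and `s.Q`,
  -- by `trim_eq`.
  have key : s.Q[fun ω => -Y ω | ℱ t]
      =ᵐ[P] P[fun ω => (s.Q.rnDeriv P ω).toReal * -Y ω | ℱ t] := by
    refine ae_eq_condExp_of_forall_setIntegral_eq (ℱ.le t) hint (fun _ _ _ => hcP.integrableOn)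
      (fun A hA _ => ?_) hsm.aestronglyMeasurable
    rw [setIntegral_trim (ℱ.le t) hsm hA, ← s.trim_eq, ← setIntegral_trim (ℱ.le t) hsm hA,
      setIntegral_condExp (ℱ.le t) hYQ hA]
    exact (setIntegral_rnDeriv_smul s.absCont (f := fun ω => -Y ω) (ℱ.le t _ hA)).symm
  have hD : ∀ᵐ ω ∂P, ‖s.D t ω‖ ≤ 1 := by
    filter_upwards [s.mem_Icc t] with ω h
    rw [Real.norm_of_nonneg h.1]
    exact h.2
  have hpull := condExp_mul_of_stronglyMeasurable_left (s.adapted t)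
    (hint.bdd_mul ((s.adapted t).mono (ℱ.le t)).aestronglyMeasurable hD) hint
  have hcongr : P[s.D t * fun ω => (s.Q.rnDeriv P ω).toReal * -Y ω | ℱ t]
      =ᵐ[P] P[fun ω => -s.density ω * Y ω | ℱ t] := by
    refine condExp_congr_ae ?_
    filter_upwards [s.coeFn_density] with ω h
    rw [h, Pi.mul_apply]
    ring
  filter_upwards [key, hpull, hcongr] with ω h1 h2 h3
  rw [← h3, h2, Pi.mul_apply, ← h1]
  rfl

/-! ### Optimality and subgradients -/

/-- The subgradient inequality in terms of the linear functional `Y ↦ E[-Z Y | 𝓕_t]`. -/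
theorem mem_subdifferential_iff {ρ : DynamicRiskMeasure hT ℱ P} {X : Lp ℝ ∞ P} {Z : Lp ℝ 1 P} :
    Z ∈ subdifferential ρ t X ↔ 0 ≤ Z ∧ ∀ Y : Lp ℝ ∞ P, ∀ᵐ ω ∂P,
      (P[fun ω' => -Z ω' * Y ω' | ℱ t]) ω - ρ.val t Y ω ≤
        (P[fun ω' => -Z ω' * X ω' | ℱ t]) ω - ρ.val t X ω := by
  refine and_congr_right fun _ => forall_congr' fun Y => eventually_congr ?_
  have h := condExp_sub (integrable_neg_mul Z Y) (integrable_neg_mul Z X) (ℱ t)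
  have h' : P[fun ω' => -Z ω' * (Y ω' - X ω') | ℱ t]
      = P[(fun ω' => -Z ω' * Y ω') - (fun ω' => -Z ω' * X ω') | ℱ t] := by
    congr 1
    ext ω
    simp only [Pi.sub_apply]
    ring
  filter_upwards [h] with ω hω
  rw [h', hω, Pi.sub_apply]
  constructor <;> intro <;> linarith

theorem coeFn_toEReal {f : Ω → ℝ} (hf : AEStronglyMeasurable f P) :
    toEReal f hf =ᵐ[P] fun ω => (f ω : EReal) :=
  AEEqFun.coeFn_mk _ _

theorem Scenario.density_nonneg (s : Scenario ℱ P t) : 0 ≤ s.density := by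
  rw [← Lp.coeFn_nonneg]
  filter_upwards [s.coeFn_density, s.mem_Icc t] with ω h h'
  rw [h]
  exact mul_nonneg h'.1 ENNReal.toReal_nonneg

theorem coeFn_dualObjective (ρ : DynamicRiskMeasure hT ℱ P) (X : Lp ℝ ∞ P)
    (s : Scenario ℱ P t) :
    dualObjective ρ X s
      =ᵐ[P] fun ω => (s.discountedLoss X ω : EReal) - minimalPenalty ρ s ω :=
  AEEqFun.coeFn_mk _ _

theorem le_minimalPenalty (ρ : DynamicRiskMeasure hT ℱ P) (s : Scenario ℱ P t)
    (Y : Lp ℝ ∞ P) :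
    ∀ᵐ ω ∂P, ((s.discountedLoss Y ω - ρ.val t Y ω : ℝ) : EReal) ≤ minimalPenalty ρ s ω := by
  have hle := AEEqFun.coeFn_le.2 ((isLUB_familyEssSup (P := P) _).1 (Set.mem_range_self
    (f := fun X : Lp ℝ ∞ P => toEReal (fun ω => s.discountedLoss X ω - ρ.val t X ω)
      ((s.discountedLoss_aestronglyMeasurable X).sub (Lp.aestronglyMeasurable _))) Y))
  filter_upwards [hle, coeFn_toEReal ((s.discountedLoss_aestronglyMeasurable Y).sub
    (Lp.aestronglyMeasurable (ρ.val t Y)))] with ω h1 h2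
  exact h2.symm.le.trans h1

/-- A scenario attains `ρ_t(X)` in the dual representation exactly when its density is a
subgradient. -/
theorem dualObjective_eq_iff (ρ : DynamicRiskMeasure hT ℱ P) (X : Lp ℝ ∞ P)
    (s : Scenario ℱ P t) :
    dualObjective ρ X s = toEReal (ρ.val t X) (Lp.aestronglyMeasurable _) ↔
      s.density ∈ subdifferential ρ t X := by
  rw [mem_subdifferential_iff]
  constructor
  · intro h
    refine ⟨s.density_nonneg, fun Y => ?_⟩
    filter_upwards [coeFn_dualObjective ρ X s, coeFn_toEReal (Lp.aestronglyMeasurable (ρ.val t X)),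
      le_minimalPenalty ρ s Y, s.discountedLoss_ae_eq X, s.discountedLoss_ae_eq Y]
      with ω h1 h2 h3 h4 h5
    rw [h, h2] at h1
    rw [← h4, ← h5]
    -- The penalty is finite here: `h3` bounds it below by a real, and `⊤` would make the objective
    -- `⊥` instead of `ρ_t(X)`.
    generalize minimalPenalty ρ s ω = c at h1 h3
    induction c with
    | bot => exact absurd (le_bot_iff.1 h3) (EReal.coe_ne_bot _)
    | top => simp at h1
    | coe c =>
      norm_cast at h1 h3
      linarith
  · rintro ⟨-, h⟩
    -- The subgradient inequality says that the supremum defining the penalty is attained at `X`.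
    have hle : minimalPenalty ρ s ≤ toEReal (fun ω => s.discountedLoss X ω - ρ.val t X ω)
        ((s.discountedLoss_aestronglyMeasurable X).sub (Lp.aestronglyMeasurable _)) := by
      refine (isLUB_familyEssSup (P := P) _).2 ?_
      rintro _ ⟨Y, rfl⟩
      rw [← AEEqFun.coeFn_le]
      filter_upwards [coeFn_toEReal ((s.discountedLoss_aestronglyMeasurable X).sub
          (Lp.aestronglyMeasurable (ρ.val t X))),
        coeFn_toEReal ((s.discountedLoss_aestronglyMeasurable Y).sub
          (Lp.aestronglyMeasurable (ρ.val t Y))),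
        h Y, s.discountedLoss_ae_eq X, s.discountedLoss_ae_eq Y] with ω h1 h2 h3 h4 h5
      refine (h2.le.trans ?_).trans h1.symm.le
      rw [← h4, ← h5] at h3
      exact EReal.coe_le_coe_iff.2 h3
    refine AEEqFun.ext ?_
    filter_upwards [coeFn_dualObjective ρ X s, coeFn_toEReal (Lp.aestronglyMeasurable (ρ.val t X)),
      le_minimalPenalty ρ s X, AEEqFun.coeFn_le.2 hle,
      coeFn_toEReal ((s.discountedLoss_aestronglyMeasurable X).sub
          (Lp.aestronglyMeasurable (ρ.val t X)))] with ω h1 h2 h3 h4 h5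
    rw [h1, h2, le_antisymm (h4.trans h5.le) h3]
    norm_cast
    simp

theorem RepresentationAttainedAt.isOptimal_iff {ρ : DynamicRiskMeasure hT ℱ P} {X : Lp ℝ ∞ P}
    (hatt : RepresentationAttainedAt ρ t X) (s : Scenario ℱ P t) :
    IsOptimal ρ X s ↔ s.density ∈ subdifferential ρ t X := by
  rw [← dualObjective_eq_iff, hatt.1, IsOptimal]

/-! ### Subgradients as scenario densities -/

/-- A nonnegative integrable `Z` with `E[Z | 𝓕_t] ≤ 1` is the density of a scenario. -/
theorem exists_scenario_density_eq {Z : Lp ℝ 1 P} (hZ : 0 ≤ Z)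
    (hZ1 : P[Z | ℱ t] ≤ᵐ[P] 1) : ∃ s : Scenario ℱ P t, s.density = Z := by
  have hZ0 : 0 ≤ᵐ[P] Z := Lp.coeFn_nonneg Z |>.2 hZ
  have hZi : Integrable Z P := L1.integrable_coeFn Z
  set D : Ω → ℝ := P[Z | ℱ t] with hDdef
  have hDm : StronglyMeasurable[ℱ t] D := stronglyMeasurable_condExp
  have hD0 : 0 ≤ᵐ[P] D := condExp_nonneg hZ0
  set N : Set Ω := {ω | D ω = 0}
  have hN : MeasurableSet[ℱ t] N := hDm.measurable (measurableSet_singleton 0)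
  have hZN : ∀ᵐ ω ∂P, ω ∈ N → Z ω = 0 := by
    have h0 : ∫ ω in N, Z ω ∂P = 0 := by
      rw [← setIntegral_condExp (ℱ.le t) hZi hN]
      exact setIntegral_eq_zero_of_forall_eq_zero fun ω hω => hω
    rw [setIntegral_eq_zero_iff_of_nonneg_ae (ae_restrict_of_ae hZ0) hZi.integrableOn] at h0
    exact (ae_restrict_iff' (ℱ.le t _ hN)).1 h0
  let Zm : Ω → ℝ := (Lp.aestronglyMeasurable Z).mk Z
  have hZm : Measurable Zm := (Lp.aestronglyMeasurable Z).stronglyMeasurable_mk.measurable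
  have hZZm : Z =ᵐ[P] Zm := (Lp.aestronglyMeasurable Z).ae_eq_mk
  have hDm' : Measurable D := (hDm.mono (ℱ.le t)).measurable
  have hN' : MeasurableSet N := ℱ.le t _ hN
  -- `Z / D` normalises `Z` conditionally off `N`. On `N`, where `Z` vanishes too, `q` is `1` (as
  -- `0⁻¹ = 0`), so `Q = P` on `ℱ t` there as well.
  let q : Ω → ℝ≥0∞ := fun ω =>
    N.indicator 1 ω + ENNReal.ofReal (D ω)⁻¹ * ENNReal.ofReal (Zm ω)
  have hq : Measurable q :=
    (measurable_one.indicator hN').add (hDm'.inv.ennreal_ofReal.mul hZm.ennreal_ofReal)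
  have hqA : ∀ A, MeasurableSet[ℱ t] A → ∫⁻ ω in A, q ω ∂P = P A := by
    intro A hA
    have hZmD : P[Zm | ℱ t] =ᵐ[P] D := condExp_congr_ae hZZm.symm
    have hg : Measurable[ℱ t] fun ω => ENNReal.ofReal (D ω)⁻¹ :=
      hDm.measurable.inv.ennreal_ofReal
    rw [lintegral_add_left (measurable_one.indicator hN'),
      setLIntegral_mul_ofReal_condExp (ℱ.le t) hZm (hZi.congr hZZm) (hZ0.trans_eq hZZm) hg hA,
      ← lintegral_add_left (measurable_one.indicator hN'), ← setLIntegral_one]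
    refine lintegral_congr_ae (ae_restrict_of_ae ?_)
    filter_upwards [hZmD, hD0] with ω h1 h2
    rw [h1, ← ENNReal.ofReal_mul (inv_nonneg.2 h2)]
    by_cases hω : ω ∈ N
    · simp [hω, show D ω = 0 from hω]
    · simp [hω, inv_mul_cancel₀ (show D ω ≠ 0 from hω)]
  let Q : Measure Ω := P.withDensity q
  have hQ : ∀ A, MeasurableSet[ℱ t] A → Q A = P A := fun A hA => by
    rw [withDensity_apply _ (ℱ.le t _ hA), hqA A hA]
  have hprob : IsProbabilityMeasure Q := ⟨by rw [hQ _ MeasurableSet.univ, measure_univ]⟩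
  let s : Scenario ℱ P t :=
    -- Only the value at `t` enters the density; `0` before `t` keeps the process adapted.
    { D := fun r => if t ≤ r then D else 0
      adapted := fun r => by
        by_cases h : t ≤ r
        · simpa [h] using hDm.mono (ℱ.mono h)
        · simpa [h] using stronglyMeasurable_zero
      mem_Icc := fun r => by
        filter_upwards [hD0, hZ1] with ω h0 h1
        by_cases h : t ≤ r
        · simpa [h] using ⟨h0, h1⟩
        · simp [h]
      Q := Q
      isProb := hprob
      absCont := withDensity_absolutelyContinuous _ _
      trim_eq := @Measure.ext _ (ℱ t) _ _ fun A hA => by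
        rw [trim_measurableSet_eq _ hA, trim_measurableSet_eq _ hA, hQ A hA] }
  refine ⟨s, Lp.ext ?_⟩
  filter_upwards [s.coeFn_density, Measure.rnDeriv_withDensity P hq, hZN, hZZm, hD0, hZ0]
    with ω h1 h2 h3 h4 h5 h6
  have h7 : s.D t ω = D ω := by simp [s]
  rw [h1, h7]
  change D ω * (Q.rnDeriv P ω).toReal = _
  rw [h2]
  by_cases hω : ω ∈ N
  · rw [h3 hω, show D ω = 0 from hω, zero_mul]
  · have hne : D ω ≠ 0 := hω
    simp only [q, Set.indicator_of_notMem hω, zero_add, ENNReal.toReal_mul]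
    rw [ENNReal.toReal_ofReal (inv_nonneg.2 h5), ENNReal.toReal_ofReal (h4 ▸ h6), ← h4,
      mul_inv_cancel_left₀ hne]

/-- Cash-subadditivity bounds the conditional mass of a subgradient by one. -/
theorem CashSubadditive.condExp_le_one {ρ : DynamicRiskMeasure hT ℱ P} (hcsa : CashSubadditive ρ)
    {X : Lp ℝ ∞ P} {Z : Lp ℝ 1 P} (hZ : Z ∈ subdifferential ρ t X) : P[Z | ℱ t] ≤ᵐ[P] 1 := by
  let m : Lp ℝ ∞ P := Lp.const ∞ P (1 : ℝ)
  have hm : m =ᵐ[P] fun _ => (1 : ℝ) := Lp.coeFn_const ..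
  have hmF : m ∈ LInfty (ℱ t) P :=
    ⟨fun _ => 1, stronglyMeasurable_const, hm⟩
  have hm0 : 0 ≤ m := by
    rw [← Lp.coeFn_nonneg]
    filter_upwards [hm] with ω h
    rw [h]
    exact zero_le_one
  -- With `m = 1`, this gives `ρ_t(X - 1) ≤ ρ_t(X) + 1`, while the subgradient inequality at `X - 1`
  -- gives `ρ_t(X) + E[Z | ℱ t] ≤ ρ_t(X - 1)`.
  have h1 := hcsa t (X - m) m hmF hm0
  rw [sub_add_cancel, ← Lp.coeFn_le] at h1
  have hcongr : P[fun ω => -Z ω * ((X - m : Lp ℝ ∞ P) ω - X ω) | ℱ t] =ᵐ[P] P[Z | ℱ t] := by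
    refine condExp_congr_ae ?_
    filter_upwards [hm, Lp.coeFn_sub X m] with ω h h'
    rw [h', Pi.sub_apply, h]
    ring
  filter_upwards [h1, hZ.2 (X - m), hcongr, hm, Lp.coeFn_sub (ρ.val t (X - m)) m]
    with ω a1 a2 a3 a4 a5
  rw [a5, Pi.sub_apply, a4] at a1
  rw [a3] at a2
  rw [Pi.one_apply]
  linarith

/-! ### Directional derivatives and uniqueness -/

/-- An integrable function is determined by the conditional expectations `E[-Z Y | 𝒢]`,
`Y ∈ L^∞`. -/
theorem eq_of_condExp_neg_mul_ae_eq {Z G : Lp ℝ 1 P}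
    (h : ∀ Y : Lp ℝ ∞ P, P[fun ω => -Z ω * Y ω | ℱ t] =ᵐ[P] P[fun ω => -G ω * Y ω | ℱ t]) :
    Z = G := by
  refine Lp.ext (Integrable.ae_eq_of_forall_setIntegral_eq _ _ (L1.integrable_coeFn Z)
    (L1.integrable_coeFn G) fun A hA _ => ?_)
  let Y : Lp ℝ ∞ P := indicatorConstLp ∞ hA (measure_ne_top P A) (1 : ℝ)
  have key : ∀ W : Lp ℝ 1 P, ∫ ω in A, W ω ∂P = -∫ ω, (P[fun ω => -W ω * Y ω | ℱ t]) ω ∂P := by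
    intro W
    rw [integral_condExp (ℱ.le t), ← integral_neg, ← integral_indicator hA]
    refine integral_congr_ae ?_
    have hY : Y =ᵐ[P] A.indicator fun _ => (1 : ℝ) := indicatorConstLp_coeFn
    filter_upwards [hY] with ω hω
    rw [hω]
    by_cases hA' : ω ∈ A <;> simp [hA']
  rw [key, key, integral_congr_ae (h Y)]

/-- A right directional derivative dominates every subgradient. -/
theorem HasRightDirectionalDeriv.condExp_le {ρ : DynamicRiskMeasure hT ℱ P} {X Y : Lp ℝ ∞ P}
    {L : Ω → ℝ} (hL : HasRightDirectionalDeriv ρ t X Y L) {Z : Lp ℝ 1 P}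
    (hZ : Z ∈ subdifferential ρ t X) : P[fun ω => -Z ω * Y ω | ℱ t] ≤ᵐ[P] L := by
  -- A single sequence suffices, and its countability leaves one null set for all `n`.
  let h : ℕ → ℝ := fun n => 1 / ((n : ℝ) + 1)
  have hpos : ∀ n, 0 < h n := fun n => Nat.one_div_pos_of_nat
  have hbound : ∀ᵐ ω ∂P, ∀ n, (P[fun ω => -Z ω * Y ω | ℱ t]) ω ≤
      (ρ.val t (X + h n • Y) ω - ρ.val t X ω) / h n := by
    refine ae_all_iff.2 fun n => ?_
    have hc : P[fun ω => -Z ω * ((X + h n • Y : Lp ℝ ∞ P) ω - X ω) | ℱ t]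
        =ᵐ[P] h n • P[fun ω => -Z ω * Y ω | ℱ t] := by
      refine EventuallyEq.trans (condExp_congr_ae ?_) (condExp_smul (h n) _ (ℱ t))
      filter_upwards [Lp.coeFn_add X (h n • Y), Lp.coeFn_smul (h n) Y] with ω h1 h2
      rw [h1, Pi.add_apply, h2]
      simp only [Pi.smul_apply, smul_eq_mul]
      ring
    filter_upwards [hc, hZ.2 (X + h n • Y)] with ω h1 h2
    rw [h1] at h2
    rw [le_div_iff₀ (hpos n)]
    simp only [Pi.smul_apply, smul_eq_mul] at h2
    linarith
  filter_upwards [hbound, hL h hpos tendsto_one_div_add_atTop_nhds_zero_nat] with ω h1 h2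
  exact ge_of_tendsto' h2 h1

theorem condExp_neg_mul_neg (Z : Lp ℝ 1 P) (Y : Lp ℝ ∞ P) :
    P[fun ω => -Z ω * (-Y : Lp ℝ ∞ P) ω | ℱ t] =ᵐ[P] -P[fun ω => -Z ω * Y ω | ℱ t] := by
  refine EventuallyEq.trans (condExp_congr_ae ?_) (condExp_neg _ (ℱ t))
  filter_upwards [Lp.coeFn_neg Y] with ω h
  rw [h]
  simp

theorem HasDirectionalDeriv.right {ρ : DynamicRiskMeasure hT ℱ P} {X Y : Lp ℝ ∞ P} {L : Ω → ℝ}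
    (hL : HasDirectionalDeriv ρ t X Y L) : HasRightDirectionalDeriv ρ t X Y L :=
  fun h hpos h0 => hL h (fun n => (hpos n).ne') h0

theorem HasDirectionalDeriv.neg {ρ : DynamicRiskMeasure hT ℱ P} {X Y : Lp ℝ ∞ P} {L : Ω → ℝ}
    (hL : HasDirectionalDeriv ρ t X Y L) : HasDirectionalDeriv ρ t X (-Y) (-L) := by
  intro h hne h0
  filter_upwards [hL (fun n => -h n) (fun n => neg_ne_zero.2 (hne n)) (by simpa using h0.neg)]
    with ω hω
  rw [Pi.neg_apply]
  refine hω.neg.congr fun n => ?_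
  rw [smul_neg, ← neg_smul, div_neg, neg_neg]

/-- A two-sided directional derivative is given by every subgradient. -/
theorem HasDirectionalDeriv.condExp_eq {ρ : DynamicRiskMeasure hT ℱ P} {X Y : Lp ℝ ∞ P}
    {L : Ω → ℝ} (hL : HasDirectionalDeriv ρ t X Y L) {Z : Lp ℝ 1 P}
    (hZ : Z ∈ subdifferential ρ t X) : P[fun ω => -Z ω * Y ω | ℱ t] =ᵐ[P] L := by
  filter_upwards [hL.right.condExp_le hZ, hL.neg.right.condExp_le hZ, condExp_neg_mul_neg Z Y]
    with ω h1 h2 h3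
  rw [h3] at h2
  exact le_antisymm h1 (neg_le_neg_iff.1 h2)

end

end DynRisk

theorem mainTheorem5 {Ω : Type*} {mΩ : MeasurableSpace Ω} (P : Measure Ω) [IsProbabilityMeasure P]
    (T : ℝ) (hT : 0 < T) (ℱ : Filtration (Set.Icc (0 : ℝ) T) mΩ)
    (hℱ0 : ℱ ⟨0, le_rfl, hT.le⟩ = ⊥) (hℱT : ℱ ⟨T, hT.le, le_rfl⟩ = mΩ)
    (ρ : DynRisk.DynamicRiskMeasure hT ℱ P)
    (hcsa : DynRisk.CashSubadditive ρ) (hcfa : DynRisk.ContinuousFromAbove ρ)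
    (t : Set.Icc (0 : ℝ) T) (X : Lp ℝ ∞ P)
    (hatt : DynRisk.RepresentationAttainedAt ρ t X) :
    (∀ s : DynRisk.Scenario ℱ P t,
      DynRisk.IsOptimal ρ X s ↔ s.density ∈ DynRisk.subdifferential ρ t X) ∧
    (∀ Z ∈ DynRisk.subdifferential ρ t X,
      ∃ s : DynRisk.Scenario ℱ P t, DynRisk.IsOptimal ρ X s ∧ s.density = Z) ∧
    ((∀ Y : Lp ℝ ∞ P, ∃ L : Ω → ℝ, DynRisk.HasDirectionalDeriv ρ t X Y L) →
      ∃ Z, DynRisk.subdifferential ρ t X = {Z}) ∧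
    (DynRisk.GateauxDifferentiableAt ρ t X →
      ∃ Z, DynRisk.subdifferential ρ t X = {Z}) := by
  obtain ⟨s₀, hs₀⟩ := hatt.2
  have hs₀' := (hatt.isOptimal_iff s₀).1 hs₀
  refine ⟨hatt.isOptimal_iff, fun Z hZ => ?_, fun hdir => ?_, ?_⟩
  · obtain ⟨s, rfl⟩ := DynRisk.exists_scenario_density_eq hZ.1 (hcsa.condExp_le_one hZ)
    exact ⟨s, (hatt.isOptimal_iff s).2 hZ, rfl⟩
  · refine ⟨s₀.density, Set.eq_singleton_iff_unique_mem.2 ⟨hs₀', fun Z hZ => ?_⟩⟩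
    refine DynRisk.eq_of_condExp_neg_mul_ae_eq (ℱ := ℱ) (t := t) fun Y => ?_
    obtain ⟨L, hL⟩ := hdir Y
    exact (hL.condExp_eq hZ).trans (hL.condExp_eq hs₀').symm
  · rintro ⟨G, -, hG⟩
    have hZG : ∀ Z ∈ DynRisk.subdifferential ρ t X, Z = G := by
      intro Z hZ
      refine DynRisk.eq_of_condExp_neg_mul_ae_eq (ℱ := ℱ) (t := t) fun Y => ?_
      -- The limit is only one-sided, but both sides are linear in `Y`, so replacing `Y` by `-Y`
      -- reverses the inequality.
      have hcomm : ∀ Y : Lp ℝ ∞ P, P[fun ω => -Z ω * Y ω | ℱ t] ≤ᵐ[P]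
          P[fun ω => -G ω * Y ω | ℱ t] := fun Y => by
        have hswap : (fun ω => -G ω * Y ω) = fun ω => -Y ω * G ω := by
          ext ω
          ring
        rw [hswap]
        exact (hG Y).condExp_le hZ
      filter_upwards [hcomm Y, hcomm (-Y), DynRisk.condExp_neg_mul_neg (ℱ := ℱ) (t := t) Z Y,
        DynRisk.condExp_neg_mul_neg (ℱ := ℱ) (t := t) G Y] with ω h1 h2 h3 h4
      rw [h3, h4] at h2
      exact le_antisymm h1 (neg_le_neg_iff.1 h2)
    exact ⟨s₀.density, Set.eq_singleton_iff_unique_mem.2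
      ⟨hs₀', fun Z hZ => (hZG Z hZ).trans (hZG _ hs₀').symm⟩⟩
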